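/- Let $1\le p<\infty$, and let $E$ and $F$ be (real) Banach lattices, with topological duals $E^*$ and $F^*$; the dual of a Banach lattice carries the operator norm and the order $f\le g \iff f(x)\le g(x)$ for all $x\ge 0$, for which it is again a Banach lattice. A sequence $(x_n)_n$ in a Banach space $X$ is weakly $p$-summable if $\sum_n|\varphi(x_n)|^p<\infty$ for every $\varphi\in X^*$, and a sequence $(x_n)_n$ in a Banach lattice is disjoint if $|x_n|\wedge|x_m|=0$ for all $n\ne m$. A bounded linear operator $S$ from a Banach lattice $G$ to a Banach space is disjoint $p$-convergent if $\|S x_n\|\to 0$ for every disjoint weakly $p$-summable sequence $(x_n)_n$ in $G$. A Banach lattice has the disjoint property of order $p$ if each bounded disjoint sequence in it is weakly $p$-summable, and it has the positive Schur property of order $p$ if every weakly $p$-summable sequence of positive elements in it is norm null. Suppose that $E$ has the disjoint property of order $p$, or that $F^*$ has the positive Schur property of order $p$. Then for every positive disjoint $p$-convergent bounded linear operator $T\colon E\to F$, the adjoint $T^*\colon F^*\to E^*$ is disjoint $p$-convergent. -/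

import Mathlib

open Filter Topology

noncomputable section

namespace BanachLat

/-! ### The dual of a normed lattice

`StrongDual ℝ E`, with its operator norm, is ordered by its dual cone: `f ≤ g` when
`f x ≤ g x` for all `x ≥ 0`.  For this order it is a lattice with a solid norm. -/

section Dual

set_option linter.unusedSectionVars false

variable {E : Type*} [NormedAddCommGroup E] [NormedSpace ℝ E] [Lattice E]
  [HasSolidNorm E] [IsOrderedAddMonoid E]

/-- The order of the dual: `f ≤ g` if and only if `f x ≤ g x` for every `x ≥ 0`. -/
instance dualPartialOrder : PartialOrder (StrongDual ℝ E) where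
  le f g := ∀ x : E, 0 ≤ x → f x ≤ g x
  le_refl _ _ _ := le_rfl
  le_trans _ _ _ h₁ h₂ x hx := (h₁ x hx).trans (h₂ x hx)
  le_antisymm f g h₁ h₂ := by
    have key : ∀ x : E, 0 ≤ x → f x = g x := fun x hx => le_antisymm (h₁ x hx) (h₂ x hx)
    ext x
    rw [← posPart_sub_negPart x, map_sub, map_sub, key _ (posPart_nonneg x),
      key _ (negPart_nonneg x)]

theorem dual_le_iff {f g : StrongDual ℝ E} : f ≤ g ↔ ∀ x : E, 0 ≤ x → f x ≤ g x := Iff.rfl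

instance dualIsOrderedAddMonoid : IsOrderedAddMonoid (StrongDual ℝ E) where
  add_le_add_left f g h k x hx := by
    simpa using h x hx

instance dualIsOrderedModule : IsOrderedModule ℝ (StrongDual ℝ E) where
  smul_le_smul_of_nonneg_left c hc f g h x hx := by
    simpa using mul_le_mul_of_nonneg_left (h x hx) hc
  smul_le_smul_of_nonneg_right f hf c d h x hx := by
    have := hf x hx
    simpa using mul_le_mul_of_nonneg_right h this

/-- The set `{f y : 0 ≤ y ≤ x}`. -/
def valuesBelow (f : StrongDual ℝ E) (x : E) : Set ℝ := f '' Set.Icc 0 x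

theorem norm_le_of_mem_Icc {x y : E} (hy : y ∈ Set.Icc 0 x) : ‖y‖ ≤ ‖x‖ := by
  refine norm_le_norm_of_abs_le_abs ?_
  rw [abs_of_nonneg hy.1, abs_of_nonneg (hy.1.trans hy.2)]
  exact hy.2

theorem valuesBelow_le (f : StrongDual ℝ E) (x : E) {r : ℝ} (hr : r ∈ valuesBelow f x) :
    r ≤ ‖f‖ * ‖x‖ := by
  obtain ⟨y, hy, rfl⟩ := hr
  calc f y ≤ ‖f y‖ := Real.le_norm_self _
    _ ≤ ‖f‖ * ‖y‖ := f.le_opNorm y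
    _ ≤ ‖f‖ * ‖x‖ := by gcongr; exact norm_le_of_mem_Icc hy

theorem bddAbove_valuesBelow (f : StrongDual ℝ E) (x : E) : BddAbove (valuesBelow f x) :=
  ⟨_, fun _ hr => valuesBelow_le f x hr⟩

theorem zero_mem_valuesBelow (f : StrongDual ℝ E) {x : E} (hx : 0 ≤ x) :
    (0 : ℝ) ∈ valuesBelow f x := ⟨0, ⟨le_rfl, hx⟩, map_zero f⟩

open scoped Pointwise in
theorem valuesBelow_add (f : StrongDual ℝ E) {x y : E} (hx : 0 ≤ x) (hy : 0 ≤ y) :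
    valuesBelow f (x + y) = valuesBelow f x + valuesBelow f y := by
  ext r
  constructor
  · rintro ⟨z, hz, rfl⟩
    refine ⟨f (z ⊓ x), ⟨z ⊓ x, ⟨le_inf hz.1 hx, inf_le_right⟩, rfl⟩, f (z - z ⊓ x),
      ⟨z - z ⊓ x, ⟨sub_nonneg.2 inf_le_left, ?_⟩, rfl⟩, ?_⟩
    · rw [sub_le_iff_le_add, add_inf]
      exact le_inf (le_add_of_nonneg_left hy) (by simpa [add_comm] using hz.2)
    · simp
  · rintro ⟨_, ⟨u, hu, rfl⟩, _, ⟨v, hv, rfl⟩, rfl⟩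
    exact ⟨u + v, ⟨add_nonneg hu.1 hv.1, add_le_add hu.2 hv.2⟩, map_add f u v⟩

/-- The Riesz–Kantorovich formula `f⁺ x = sup {f y : 0 ≤ y ≤ x}`, on the positive cone. -/
def conePos (f : StrongDual ℝ E) (x : E) : ℝ := sSup (valuesBelow f x)

theorem le_conePos (f : StrongDual ℝ E) {x y : E} (hy : y ∈ Set.Icc 0 x) : f y ≤ conePos f x :=
  le_csSup (bddAbove_valuesBelow f x) ⟨y, hy, rfl⟩

theorem conePos_le (f : StrongDual ℝ E) {x : E} (hx : 0 ≤ x) {c : ℝ}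
    (h : ∀ y ∈ Set.Icc 0 x, f y ≤ c) : conePos f x ≤ c := by
  refine csSup_le ⟨0, zero_mem_valuesBelow f hx⟩ ?_
  rintro _ ⟨y, hy, rfl⟩
  exact h y hy

theorem conePos_nonneg (f : StrongDual ℝ E) {x : E} (hx : 0 ≤ x) : 0 ≤ conePos f x :=
  le_csSup (bddAbove_valuesBelow f x) (zero_mem_valuesBelow f hx)

theorem conePos_add (f : StrongDual ℝ E) {x y : E} (hx : 0 ≤ x) (hy : 0 ≤ y) :
    conePos f (x + y) = conePos f x + conePos f y := by
  rw [conePos, valuesBelow_add f hx hy]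
  exact csSup_add ⟨0, zero_mem_valuesBelow f hx⟩ (bddAbove_valuesBelow f x)
    ⟨0, zero_mem_valuesBelow f hy⟩ (bddAbove_valuesBelow f y)

theorem conePos_zero (f : StrongDual ℝ E) : conePos f 0 = 0 := by
  have := conePos_add f (le_refl (0 : E)) (le_refl (0 : E))
  simp only [add_zero] at this
  linarith

/-- The positive part of a functional, as an additive map. -/
def posPartHom (f : StrongDual ℝ E) : E →+ ℝ where
  toFun x := conePos f x⁺ - conePos f x⁻
  map_zero' := by simp
  map_add' x y := by
    have h : (x + y)⁺ + (x⁻ + y⁻) = (x⁺ + y⁺) + (x + y)⁻ := by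
      have h₁ := posPart_sub_negPart (x + y)
      have h₂ := posPart_sub_negPart x
      have h₃ := posPart_sub_negPart y
      have h₄ : (x + y)⁺ - (x + y)⁻ = (x⁺ - x⁻) + (y⁺ - y⁻) := by rw [h₁, h₂, h₃]
      rw [sub_eq_iff_eq_add] at h₄
      rw [h₄]
      abel
    have h' := congrArg (conePos f) h
    have px := posPart_nonneg x
    have py := posPart_nonneg y
    have nx := negPart_nonneg x
    have ny := negPart_nonneg y
    rw [conePos_add f (posPart_nonneg _) (add_nonneg nx ny), conePos_add f nx ny,
      conePos_add f (add_nonneg px py) (negPart_nonneg _), conePos_add f px py] at h'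
    linarith

theorem posPartHom_of_nonneg (f : StrongDual ℝ E) {x : E} (hx : 0 ≤ x) :
    posPartHom f x = conePos f x := by
  change conePos f x⁺ - conePos f x⁻ = _
  rw [posPart_of_nonneg hx, negPart_of_nonneg hx, conePos_zero, sub_zero]

theorem norm_posPartHom_le (f : StrongDual ℝ E) (x : E) : ‖posPartHom f x‖ ≤ ‖f‖ * ‖x‖ := by
  have bound : ∀ z : E, 0 ≤ z → z ≤ |x| → conePos f z ≤ ‖f‖ * ‖x‖ := fun z hz hzx =>
    conePos_le f hz fun y hy => (valuesBelow_le f z ⟨y, hy, rfl⟩).trans <| by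
      gcongr
      refine norm_le_norm_of_abs_le_abs ?_
      rwa [abs_of_nonneg hz]
  have hp : x⁺ ≤ |x| := sup_le (le_abs_self x) (abs_nonneg x)
  have hn : x⁻ ≤ |x| := sup_le (neg_le_abs x) (abs_nonneg x)
  have h₁ := bound _ (posPart_nonneg x) hp
  have h₂ := bound _ (negPart_nonneg x) hn
  have h₃ := conePos_nonneg f (posPart_nonneg x)
  have h₄ := conePos_nonneg f (negPart_nonneg x)
  rw [Real.norm_eq_abs, abs_le]
  change -_ ≤ conePos f x⁺ - conePos f x⁻ ∧ conePos f x⁺ - conePos f x⁻ ≤ _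
  constructor <;> linarith

/-- The positive part `f⁺` of a continuous functional. -/
def dualPos (f : StrongDual ℝ E) : StrongDual ℝ E :=
  (posPartHom f).toRealLinearMap
    (AddMonoidHomClass.continuous_of_bound (posPartHom f) ‖f‖ (norm_posPartHom_le f))

theorem dualPos_apply (f : StrongDual ℝ E) {x : E} (hx : 0 ≤ x) :
    dualPos f x = conePos f x := posPartHom_of_nonneg f hx

/-- The lattice structure of the dual: `f ⊔ g = (f - g)⁺ + g` and `f ⊓ g = f - (f - g)⁺`. -/
instance dualLattice : Lattice (StrongDual ℝ E) where
  sup f g := dualPos (f - g) + g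
  inf f g := f - dualPos (f - g)
  le_sup_left f g x hx := by
    have := le_conePos (f - g) (Set.right_mem_Icc.2 hx)
    rw [sub_apply] at this
    rw [add_apply, dualPos_apply _ hx]
    linarith
  le_sup_right f g x hx := by
    have := conePos_nonneg (f - g) hx
    rw [add_apply, dualPos_apply _ hx]
    linarith
  sup_le f g h hf hg x hx := by
    have : conePos (f - g) x ≤ h x - g x := conePos_le _ hx fun y hy => by
      have h₁ := hf y hy.1
      have h₂ := hg (x - y) (sub_nonneg.2 hy.2)
      rw [map_sub, map_sub] at h₂
      rw [sub_apply]
      linarith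
    rw [add_apply, dualPos_apply _ hx]
    linarith
  inf_le_left f g x hx := by
    have := conePos_nonneg (f - g) hx
    rw [sub_apply, dualPos_apply _ hx]
    linarith
  inf_le_right f g x hx := by
    have := le_conePos (f - g) (Set.right_mem_Icc.2 hx)
    rw [sub_apply] at this
    rw [sub_apply, dualPos_apply _ hx]
    linarith
  le_inf h f g hf hg x hx := by
    have : conePos (f - g) x ≤ f x - h x := conePos_le _ hx fun y hy => by
      have h₁ := hg y hy.1
      have h₂ := hf (x - y) (sub_nonneg.2 hy.2)
      rw [map_sub, map_sub] at h₂
      rw [sub_apply]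
      linarith
    rw [sub_apply, dualPos_apply _ hx]
    linarith

theorem dual_sup_apply (f g : StrongDual ℝ E) {x : E} (hx : 0 ≤ x) :
    (f ⊔ g) x = conePos (f - g) x + g x := by
  change (dualPos (f - g) + g) x = _
  rw [add_apply, dualPos_apply _ hx]

theorem dual_abs_apply_le (f : StrongDual ℝ E) {x : E} (hx : 0 ≤ x) : |f| x ≤ ‖f‖ * ‖x‖ := by
  have key : conePos (f - -f) x ≤ ‖f‖ * ‖x‖ + f x := conePos_le _ hx fun y hy => by
    have h₁ : |y + y - x| ≤ |x| := by
      rw [abs_of_nonneg hx]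
      refine abs_le'.2 ⟨?_, ?_⟩
      · rw [sub_le_iff_le_add]
        exact add_le_add hy.2 hy.2
      · rw [neg_sub]
        exact sub_le_self _ (add_nonneg hy.1 hy.1)
    have h₂ : f (y + y - x) ≤ ‖f‖ * ‖x‖ := calc
      f (y + y - x) ≤ ‖f (y + y - x)‖ := Real.le_norm_self _
      _ ≤ ‖f‖ * ‖y + y - x‖ := f.le_opNorm _
      _ ≤ ‖f‖ * ‖x‖ := by gcongr; exact norm_le_norm_of_abs_le_abs h₁
    rw [map_sub, map_add] at h₂
    rw [sub_apply, neg_apply]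
    linarith
  have h : |f| x = conePos (f - -f) x + (-f) x := dual_sup_apply f (-f) hx
  rw [h, neg_apply]
  linarith

instance dualHasSolidNorm : HasSolidNorm (StrongDual ℝ E) where
  solid f g h := by
    refine f.opNorm_le_bound (norm_nonneg g) fun x => ?_
    have pos : ∀ z : E, 0 ≤ z → f z ≤ |f| z ∧ -f z ≤ |f| z := fun z hz =>
      ⟨le_abs_self f z hz, by simpa using neg_le_abs f z hz⟩
    have hp := pos _ (posPart_nonneg x)
    have hn := pos _ (negPart_nonneg x)
    have e₁ : f x = f x⁺ - f x⁻ := by rw [← map_sub, posPart_sub_negPart]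
    have e₂ : |f| |x| = |f| x⁺ + |f| x⁻ := by rw [← map_add, posPart_add_negPart]
    have h₁ := h |x| (abs_nonneg x)
    have h₂ := dual_abs_apply_le g (abs_nonneg x)
    rw [norm_abs_eq_norm] at h₂
    rw [Real.norm_eq_abs, abs_le]
    constructor <;> linarith [hp.1, hp.2, hn.1, hn.2]

end Dual

/-! ### Sequences and operators -/

/-- A sequence of a Banach space is weakly `p`-summable if `(φ (x n))` is in `ℓ_p` for every
continuous functional `φ`. -/
def WeaklyPSummable {X : Type*} [NormedAddCommGroup X] [NormedSpace ℝ X]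
    (p : ℝ) (x : ℕ → X) : Prop :=
  ∀ φ : StrongDual ℝ X, Summable fun n => |φ (x n)| ^ p

/-- A sequence is disjoint if `|x n| ∧ |x m| = 0` for all `n ≠ m`. -/
def DisjointSeq {E : Type*} [AddCommGroup E] [Lattice E] (x : ℕ → E) : Prop :=
  Pairwise fun n m => |x n| ⊓ |x m| = 0

/-- The disjoint property of order `p`: each bounded disjoint sequence is weakly
`p`-summable. -/
def DisjointProperty (p : ℝ) (E : Type*) [NormedAddCommGroup E] [NormedSpace ℝ E]
    [Lattice E] : Prop :=
  ∀ x : ℕ → E, DisjointSeq x → (∃ C : ℝ, ∀ n, ‖x n‖ ≤ C) → WeaklyPSummable p x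

/-- The positive Schur property of order `p`: each weakly `p`-summable sequence of positive
elements is norm null. -/
def PositiveSchurProperty (p : ℝ) (E : Type*) [NormedAddCommGroup E] [NormedSpace ℝ E]
    [Lattice E] : Prop :=
  ∀ x : ℕ → E, (∀ n, 0 ≤ x n) → WeaklyPSummable p x → Tendsto (fun n => ‖x n‖) atTop (𝓝 0)

/-- A bounded linear operator on a Banach lattice is disjoint `p`-convergent if it sends
disjoint weakly `p`-summable sequences to norm null sequences. -/
def DisjointPConvergent {E X : Type*} [NormedAddCommGroup E] [NormedSpace ℝ E] [Lattice E]
    [NormedAddCommGroup X] [NormedSpace ℝ X] (p : ℝ) (T : E →L[ℝ] X) : Prop :=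
  ∀ x : ℕ → E, DisjointSeq x → WeaklyPSummable p x →
    Tendsto (fun n => ‖T (x n)‖) atTop (𝓝 0)

/-- An operator is positive if it maps positive elements to positive elements. -/
def PositiveOperator {E F : Type*} [NormedAddCommGroup E] [NormedSpace ℝ E] [Lattice E]
    [NormedAddCommGroup F] [NormedSpace ℝ F] [Lattice F] (T : E →L[ℝ] F) : Prop :=
  ∀ x : E, 0 ≤ x → 0 ≤ T x

/-- The adjoint `T* : F* → E*`, `T* φ = φ ∘ T`. -/
def adjointOp {E F : Type*} [NormedAddCommGroup E] [NormedSpace ℝ E]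
    [NormedAddCommGroup F] [NormedSpace ℝ F] (T : E →L[ℝ] F) :
    StrongDual ℝ F →L[ℝ] StrongDual ℝ E :=
  T.precomp ℝ

theorem adjointOp_apply {E F : Type*} [NormedAddCommGroup E] [NormedSpace ℝ E]
    [NormedAddCommGroup F] [NormedSpace ℝ F] (T : E →L[ℝ] F) (φ : StrongDual ℝ F) (x : E) :
    adjointOp T φ x = φ (T x) := rfl

end BanachLat

end

/-! For a disjoint weakly p-summable sequence `f n` in `F*`, the moduli `|f n|` are again weakly
p-summable (`weaklyPSummable_abs`). Under the positive Schur property this already gives `‖f n‖ →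
0`. Under the disjoint property of `E`, positivity of `T` gives `|T* f n| ≤ T* |f n|`, so it
suffices that the positive functionals `T* |f n|` are norm null. They are weak* null. On a bounded
positive disjoint sequence `u k` they also vanish: `u` is weakly p-summable, so `T (u k) → 0` in
norm while `|f n|` stays bounded. A gliding hump (`tendsto_norm_zero_of_disjoint`) upgrades this to
norm convergence: almost norming vectors of a subsequence are made disjoint by
`exists_disjointSeq_of_bounded`, at small cost. -/

namespace BanachLat

/-! ### Moduli of disjoint sums -/

section DisjointSums

variable {X : Type*} [AddCommGroup X] [Lattice X] [IsOrderedAddMonoid X]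

theorem add_inf_eq_zero {a b c : X} (ha : 0 ≤ a) (hb : 0 ≤ b) (hc : 0 ≤ c) (hac : a ⊓ c = 0)
    (hbc : b ⊓ c = 0) : (a + b) ⊓ c = 0 := by
  refine le_antisymm ?_ (le_inf (add_nonneg ha hb) hc)
  have h₁ : (a + b) ⊓ c ≤ a := by
    have h : (a + b) ⊓ c - a ≤ b ⊓ c :=
      le_inf (sub_le_iff_le_add.2 (by rw [add_comm b]; exact inf_le_left))
        ((sub_le_self _ ha).trans inf_le_right)
    rwa [hbc, sub_nonpos] at h
  rw [← hac]
  exact le_inf h₁ inf_le_right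

/-- Disjointness gives `||x| - |y|| = |x| ⊔ |y| = |x| + |y|`, and the left side is at most `|x +
y|`. -/
theorem abs_add_of_inf_eq_zero {x y : X} (h : |x| ⊓ |y| = 0) : |x + y| = |x| + |y| := by
  refine le_antisymm (abs_add_le x y) ?_
  have h₁ := abs_abs_sub_abs_le x (-y)
  rw [abs_neg, sub_neg_eq_add, ← sup_sub_inf_eq_abs_sub, inf_comm, h, sub_zero, sup_comm] at h₁
  have h₂ := inf_add_sup |x| |y|
  rw [h, zero_add] at h₂
  rwa [h₂] at h₁

variable [Module ℝ X] [IsOrderedModule ℝ X]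

theorem smul_inf_smul_eq_zero {a b : X} (ha : 0 ≤ a) (hb : 0 ≤ b) (h : a ⊓ b = 0) {c d : ℝ}
    (hc : 0 ≤ c) (hd : 0 ≤ d) : (c • a) ⊓ (d • b) = 0 := by
  refine le_antisymm ?_ (le_inf (smul_nonneg hc ha) (smul_nonneg hd hb))
  -- A common bound for both scalars; the `1` keeps it invertible when `c = d = 0`.
  have hM : 0 < c + d + 1 := by positivity
  set z := (c • a) ⊓ (d • b)
  have key : (c + d + 1)⁻¹ • z ≤ 0 := by
    rw [← h]
    refine le_inf ?_ ?_
    · rw [inv_smul_le_iff_of_pos hM]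
      exact inf_le_left.trans (smul_le_smul_of_nonneg_right (by linarith) ha)
    · rw [inv_smul_le_iff_of_pos hM]
      exact inf_le_right.trans (smul_le_smul_of_nonneg_right (by linarith) hb)
  rwa [inv_smul_le_iff_of_pos hM, smul_zero] at key

theorem abs_smul_of_nonneg {c : ℝ} (hc : 0 ≤ c) (x : X) : |c • x| = c • |x| := by
  rcases hc.eq_or_lt with rfl | hc
  · simp
  · refine le_antisymm (abs_le'.2 ⟨?_, ?_⟩) ?_
    · exact smul_le_smul_of_nonneg_left (le_abs_self x) hc.le
    · rw [← smul_neg]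
      exact smul_le_smul_of_nonneg_left (neg_le_abs x) hc.le
    · rw [← le_inv_smul_iff_of_pos hc]
      refine abs_le'.2 ⟨?_, ?_⟩
      · rw [le_inv_smul_iff_of_pos hc]
        exact le_abs_self _
      · rw [le_inv_smul_iff_of_pos hc, smul_neg]
        exact neg_le_abs _

theorem abs_sum_smul_of_disjointSeq {x : ℕ → X} (hx : DisjointSeq x) {a : ℕ → ℝ}
    (ha : ∀ n, 0 ≤ a n) (N : ℕ) :
    |∑ n ∈ Finset.range N, a n • x n| = ∑ n ∈ Finset.range N, a n • |x n| := by
  have hnn : ∀ n, 0 ≤ a n • |x n| := fun n => smul_nonneg (ha n) (abs_nonneg _)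
  have disj : ∀ N m, N ≤ m → (∑ n ∈ Finset.range N, a n • |x n|) ⊓ (a m • |x m|) = 0 := by
    intro N m
    induction N with
    | zero => intro _; simpa using hnn m
    | succ N ih =>
      intro hm
      rw [Finset.sum_range_succ]
      exact add_inf_eq_zero (Finset.sum_nonneg fun n _ => hnn n) (hnn N) (hnn m)
        (ih (by omega)) (smul_inf_smul_eq_zero (abs_nonneg _) (abs_nonneg _)
          (hx (by omega)) (ha N) (ha m))
  induction N with
  | zero => simp
  | succ N ih =>
    rw [Finset.sum_range_succ, Finset.sum_range_succ, abs_add_of_inf_eq_zero, ih,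
      abs_smul_of_nonneg (ha N)]
    rw [ih, abs_smul_of_nonneg (ha N)]
    exact disj N N le_rfl

end DisjointSums

/-! ### Weak p-summability of moduli -/

/-- A crude Young inequality, by comparing `B` with `ε * A`. It replaces Hölder and covers `p = 1`
uniformly. -/
theorem rpow_sub_one_mul_le {p A B ε : ℝ} (hp : 1 ≤ p) (hA : 0 ≤ A) (hB : 0 ≤ B) (hε : 0 < ε) :
    A ^ (p - 1) * B ≤ ε * A ^ p + ε ^ (1 - p) * B ^ p := by
  have hpow : ∀ t : ℝ, 0 ≤ t → t ^ (p - 1) * t = t ^ p := fun t ht => by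
    conv_lhs => rw [← Real.rpow_add_one' ht (by linarith)]
    ring_nf
  rcases le_total B (ε * A) with h | h
  · calc A ^ (p - 1) * B ≤ A ^ (p - 1) * (ε * A) := by gcongr
      _ = ε * A ^ p := by rw [← hpow A hA]; ring
      _ ≤ _ := le_add_of_nonneg_right (by positivity)
  · have h' : A ≤ ε⁻¹ * B := by rw [le_inv_mul_iff₀ hε]; exact h
    calc A ^ (p - 1) * B ≤ (ε⁻¹ * B) ^ (p - 1) * B := by
          gcongr
      _ = ε ^ (1 - p) * B ^ p := by
          rw [Real.mul_rpow (by positivity) hB, mul_assoc, hpow B hB, Real.inv_rpow hε.le,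
            ← Real.rpow_neg hε.le, neg_sub]
      _ ≤ _ := le_add_of_nonneg_left (by positivity)

theorem bounded_of_weakly_bounded {X : Type*} [NormedAddCommGroup X] [NormedSpace ℝ X]
    {ι : Type*} {w : ι → X} (h : ∀ ψ : StrongDual ℝ X, ∃ C, ∀ i, |ψ (w i)| ≤ C) :
    ∃ C, ∀ i, ‖w i‖ ≤ C := by
  obtain ⟨C, hC⟩ := banach_steinhaus
    (g := fun i => NormedSpace.inclusionInDoubleDual ℝ X (w i)) (fun ψ => by simpa using h ψ)
  refine ⟨C, fun i => ?_⟩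
  rw [← (NormedSpace.inclusionInDoubleDualLi ℝ (E := X)).norm_map (w i)]
  exact hC i

section Lattice

variable {X : Type*} [NormedAddCommGroup X] [NormedSpace ℝ X] [Lattice X]
  [IsOrderedAddMonoid X] [HasSolidNorm X]

theorem abs_apply_le_abs_apply (φ : StrongDual ℝ X) {x : X} (hx : 0 ≤ x) : |φ x| ≤ |φ| x :=
  abs_le'.2 ⟨le_abs_self φ x hx, neg_le_abs φ x hx⟩

variable [IsOrderedModule ℝ X]

/-- The vectors `w N` carry the Hölder-extremal coefficients for `φ |x n|`. They are weakly bounded,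
hence norm bounded, and disjointness gives `φ |w N| = S N ^ (1 / p)` when `S N > 0`; so the partial
sums `S N` are bounded. -/
theorem weaklyPSummable_abs {p : ℝ} (hp : 1 ≤ p) {x : ℕ → X} (hx : DisjointSeq x)
    (hw : WeaklyPSummable p x) : WeaklyPSummable p fun n => |x n| := by
  have p0 : 0 < p := by linarith
  suffices h : ∀ φ : StrongDual ℝ X, 0 ≤ φ → Summable fun n => φ |x n| ^ p by
    intro φ
    refine (h |φ| (abs_nonneg φ)).of_nonneg_of_le (fun n => by positivity) fun n => ?_
    gcongr
    exact abs_apply_le_abs_apply φ (abs_nonneg _)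
  intro φ hφ
  have A0 : ∀ n, 0 ≤ φ |x n| := fun n => by simpa using hφ _ (abs_nonneg (x n))
  set S : ℕ → ℝ := fun N => ∑ n ∈ Finset.range N, φ |x n| ^ p with hS
  have S0 : ∀ N, 0 ≤ S N := fun N => Finset.sum_nonneg fun n _ => Real.rpow_nonneg (A0 n) p
  set v : ℕ → X := fun N => ∑ n ∈ Finset.range N, (φ |x n|) ^ (p - 1) • x n with hv
  set w : ℕ → X := fun N => (S N ^ (1 / p - 1)) • v N with hwdef
  obtain ⟨C, hC⟩ : ∃ C, ∀ N, ‖w N‖ ≤ C := by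
    refine bounded_of_weakly_bounded fun ψ => ?_
    set D := ∑' n, |ψ (x n)| ^ p
    have D0 : 0 ≤ D := tsum_nonneg fun n => by positivity
    refine ⟨1 + D, fun N => ?_⟩
    rcases (S0 N).eq_or_lt with h0 | hpos
    · have hz : ∀ n ∈ Finset.range N, (φ |x n|) = 0 := fun n hn => by
        have h1 := (Finset.sum_eq_zero_iff_of_nonneg
          fun n _ => Real.rpow_nonneg (A0 n) p).1 h0.symm n hn
        exact ((Real.rpow_eq_zero (A0 n) p0.ne').1 h1)
      -- For `p = 1` the convention `0 ^ 0 = 1` makes `w N` the plain sum of the `x n`, not zero.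
      rcases hp.eq_or_lt with rfl | hp1
      · have hle : |ψ (w N)| ≤ ∑ n ∈ Finset.range N, |ψ (x n)| ^ (1 : ℝ) := by
          simpa [hwdef, hv] using
            Finset.abs_sum_le_sum_abs (fun n => ψ (x n)) (Finset.range N)
        have := (hw ψ).sum_le_tsum (Finset.range N) fun n _ => by positivity
        exact (hle.trans this).trans (by simp [D])
      · have : v N = 0 := Finset.sum_eq_zero fun n hn => by
          rw [hz n hn, Real.zero_rpow (by linarith), zero_smul]
        simp only [hwdef, this, smul_zero, map_zero, abs_zero]
        positivity
    -- Young with `ε = S N ^ (-(1 / p))` gives both terms the same order `S N ^ (1 - 1 / p)`.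
    · have h1 : |ψ (v N)| ≤ S N ^ (1 - 1 / p) * (1 + D) := calc
        |ψ (v N)| ≤ ∑ n ∈ Finset.range N, (φ |x n|) ^ (p - 1) * |ψ (x n)| := by
            simp only [hv, map_sum, map_smul, smul_eq_mul]
            refine (Finset.abs_sum_le_sum_abs _ _).trans_eq (Finset.sum_congr rfl fun n _ => ?_)
            rw [abs_mul, abs_of_nonneg (Real.rpow_nonneg (A0 n) _)]
        _ ≤ ∑ n ∈ Finset.range N, (S N ^ (-(1 / p)) * (φ |x n|) ^ p
              + (S N ^ (-(1 / p))) ^ (1 - p) * |ψ (x n)| ^ p) :=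
            Finset.sum_le_sum fun n _ => rpow_sub_one_mul_le hp (A0 n) (abs_nonneg _)
              (Real.rpow_pos_of_pos hpos _)
        _ = S N ^ (-(1 / p)) * S N + (S N ^ (-(1 / p))) ^ (1 - p) *
              ∑ n ∈ Finset.range N, |ψ (x n)| ^ p := by
            rw [Finset.sum_add_distrib, ← Finset.mul_sum, ← Finset.mul_sum]
        _ ≤ S N ^ (-(1 / p)) * S N + (S N ^ (-(1 / p))) ^ (1 - p) * D := by
            gcongr
            exact (hw ψ).sum_le_tsum (Finset.range N) fun n _ => by positivity
        _ = S N ^ (1 - 1 / p) * (1 + D) := by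
            rw [← Real.rpow_mul hpos.le, ← Real.rpow_add_one hpos.ne', mul_add, mul_one]
            congr 2
            · ring_nf
            · congr 1
              field_simp
              ring
      have hS' := Real.rpow_pos_of_pos hpos (1 / p - 1)
      calc |ψ (w N)| = S N ^ (1 / p - 1) * |ψ (v N)| := by
            simp only [hwdef, map_smul, smul_eq_mul, abs_mul, abs_of_pos hS']
        _ ≤ S N ^ (1 / p - 1) * (S N ^ (1 - 1 / p) * (1 + D)) := by gcongr
        _ = 1 + D := by
            rw [← mul_assoc, ← Real.rpow_add hpos]
            simp
  have key : ∀ N, S N ^ (1 / p) ≤ ‖φ‖ * C := fun N => by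
    rcases (S0 N).eq_or_lt with h0 | hpos
    · rw [← h0, Real.zero_rpow (by positivity)]
      exact mul_nonneg (norm_nonneg _) ((norm_nonneg _).trans (hC 0))
    have h1 : φ |w N| = S N ^ (1 / p) := by
      have : |v N| = ∑ n ∈ Finset.range N, (φ |x n|) ^ (p - 1) • |x n| :=
        abs_sum_smul_of_disjointSeq hx (fun n => Real.rpow_nonneg (A0 n) _) N
      simp only [hwdef]
      rw [abs_smul_of_nonneg (Real.rpow_nonneg (S0 N) _), this]
      simp only [map_smul, map_sum, smul_eq_mul]
      have h2 : ∑ n ∈ Finset.range N, (φ |x n|) ^ (p - 1) * φ |x n| = S N :=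
        Finset.sum_congr rfl fun n _ => by
          conv_lhs => rw [← Real.rpow_add_one' (A0 n) (by linarith)]
          ring_nf
      rw [h2, ← Real.rpow_add_one hpos.ne']
      ring_nf
    rw [← h1]
    calc φ |w N| ≤ ‖φ‖ * ‖|w N|‖ := (Real.le_norm_self _).trans (φ.le_opNorm _)
      _ ≤ ‖φ‖ * C := by
        rw [norm_abs_eq_norm]
        gcongr
        exact hC N
  refine summable_of_sum_range_le (c := (‖φ‖ * C) ^ p) (fun n => Real.rpow_nonneg (A0 n) p)
    fun N => ?_
  calc S N = (S N ^ (1 / p)) ^ p := by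
        rw [← Real.rpow_mul (S0 N), one_div_mul_cancel p0.ne', Real.rpow_one]
    _ ≤ _ := Real.rpow_le_rpow (Real.rpow_nonneg (S0 N) _) (key N) p0.le

end Lattice

/-! ### Disjointification and norm null positive functionals -/

section Disjointification

variable {X : Type*} [AddCommGroup X] [Lattice X] [IsOrderedAddMonoid X] [Module ℝ X]
  [IsOrderedModule ℝ X]

/-- Since `c⁻¹ ≤ d`, `u⁺` and `v⁺` lie below multiples of the positive and negative parts of the
single vector `y - c • z`. -/
theorem posPart_inf_posPart_eq_zero {y z u v : X} {c d : ℝ} (hc : 0 < c) (hcd : 1 ≤ c * d)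
    (hy : 0 ≤ y) (hu : u ≤ y - c • z) (hv : v ≤ z - d • y) : v⁺ ⊓ u⁺ = 0 := by
  refine le_antisymm ?_ (le_inf (posPart_nonneg _) (posPart_nonneg _))
  have hd : c⁻¹ ≤ d := (inv_le_iff_one_le_mul₀' hc).2 hcd
  have hv' : v ≤ c⁻¹ • (-(y - c • z)) := by
    refine hv.trans ?_
    rw [neg_sub, smul_sub, inv_smul_smul₀ hc.ne']
    exact sub_le_sub_left (smul_le_smul_of_nonneg_right hd hy) z
  have h₁ : u⁺ ≤ (y - c • z)⁺ := posPart_mono hu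
  have h₂ : v⁺ ≤ c⁻¹ • (y - c • z)⁻ := by
    refine sup_le (hv'.trans ?_) (smul_nonneg (inv_nonneg.2 hc.le) (negPart_nonneg _))
    exact smul_le_smul_of_nonneg_left (neg_le_negPart _) (inv_nonneg.2 hc.le)
  have h₃ := smul_inf_smul_eq_zero (negPart_nonneg _) (posPart_nonneg _)
    ((inf_comm _ _).trans (posPart_inf_negPart_eq_zero (y - c • z))) (inv_nonneg.2 hc.le) zero_le_one
  rw [one_smul] at h₃
  rw [← h₃]
  exact inf_le_inf h₂ h₁

end Disjointification

theorem apply_le_apply {E : Type*} [NormedAddCommGroup E] [NormedSpace ℝ E] [Lattice E]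
    [IsOrderedAddMonoid E] {g : StrongDual ℝ E} (hg : 0 ≤ g) {x y : E} (h : x ≤ y) :
    g x ≤ g y := by
  simpa using hg (y - x) (sub_nonneg.2 h)

theorem exists_nonneg_norm_le_two_mul_apply {E : Type*} [NormedAddCommGroup E] [NormedSpace ℝ E]
    [Lattice E] [IsOrderedAddMonoid E] [HasSolidNorm E] {g : StrongDual ℝ E} (hg : 0 ≤ g) :
    ∃ x : E, 0 ≤ x ∧ ‖x‖ ≤ 1 ∧ ‖g‖ ≤ 2 * g x := by
  rcases (norm_nonneg g).eq_or_lt with h0 | hpos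
  · exact ⟨0, le_rfl, by simp, by simp [← h0]⟩
  obtain ⟨x, hx, hgx⟩ := g.exists_lt_apply_of_lt_opNorm (half_lt_self hpos)
  refine ⟨|x|, abs_nonneg x, by rw [norm_abs_eq_norm]; exact hx.le, ?_⟩
  have : ‖g x‖ ≤ g |x| := abs_le'.2 ⟨apply_le_apply hg (le_abs_self x), by
    rw [← map_neg]
    exact apply_le_apply hg (neg_le_abs x)⟩
  linarith

variable {E : Type*} [NormedAddCommGroup E] [NormedSpace ℝ E] [CompleteSpace E]
  [Lattice E] [IsOrderedAddMonoid E] [IsOrderedModule ℝ E] [HasSolidNorm E]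

/-- Disjointification: a bounded positive sequence, after removing large multiples of the
previous terms and a vanishing multiple of a fixed element, becomes disjoint. -/
theorem exists_disjointSeq_of_bounded {y : ℕ → E} (hy : ∀ k, 0 ≤ y k) {C : ℝ}
    (hC : ∀ k, ‖y k‖ ≤ C) :
    ∃ (s : E) (u : ℕ → E), 0 ≤ s ∧ DisjointSeq u ∧ (∀ k, 0 ≤ u k) ∧ (∀ k, u k ≤ y k) ∧
      ∀ k, y k - ((4 : ℝ) ^ k • ∑ i ∈ Finset.range k, y i + ((1 / 2 : ℝ) ^ k) • s) ≤ u k := by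
  have hsum : Summable fun k => ((1 / 2 : ℝ) ^ k) • y k := by
    refine Summable.of_norm_bounded (g := fun k => (1 / 2 : ℝ) ^ k * C)
      (summable_geometric_two.mul_right C) fun k => ?_
    rw [norm_smul, Real.norm_of_nonneg (by positivity)]
    gcongr
    exact hC k
  have hterm : ∀ k, 0 ≤ ((1 / 2 : ℝ) ^ k) • y k := fun k => smul_nonneg (by positivity) (hy k)
  set s := ∑' k, ((1 / 2 : ℝ) ^ k) • y k
  have hs : 0 ≤ s := tsum_nonneg hterm
  have hP : ∀ k, 0 ≤ ∑ i ∈ Finset.range k, y i := fun k => Finset.sum_nonneg fun i _ => hy i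
  set t : ℕ → E := fun k =>
    y k - ((4 : ℝ) ^ k • ∑ i ∈ Finset.range k, y i + ((1 / 2 : ℝ) ^ k) • s)
  have hlt : ∀ k m, k < m → (t k)⁺ ⊓ (t m)⁺ = 0 := fun k m hkm => by
    -- The sum in `t m` contains `y k`, and `s` dominates `(1 / 2) ^ m • y m`. The product of the
    -- constants is `2 ^ (m - k) ≥ 1`.
    refine posPart_inf_posPart_eq_zero (y := y m) (z := y k) (c := 4 ^ m)
      (d := (1 / 2) ^ k * (1 / 2) ^ m) (by positivity) ?_ (hy m) ?_ ?_
    · rw [one_div, inv_pow, inv_pow, ← mul_inv, ← div_eq_mul_inv, one_le_div (by positivity),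
        ← pow_add, show (4 : ℝ) = 2 ^ 2 by norm_num, ← pow_mul]
      exact pow_le_pow_right₀ (by norm_num) (by omega)
    · refine sub_le_sub_left (le_trans ?_
        (le_add_of_nonneg_right (smul_nonneg (by positivity) hs))) _
      exact smul_le_smul_of_nonneg_left
        (Finset.single_le_sum (fun i _ => hy i) (Finset.mem_range.2 hkm)) (by positivity)
    · refine sub_le_sub_left (le_trans ?_
        (le_add_of_nonneg_left (smul_nonneg (by positivity) (hP k)))) _
      rw [mul_smul]
      exact smul_le_smul_of_nonneg_left (hsum.le_tsum m fun i _ => hterm i) (by positivity)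
  refine ⟨s, fun k => (t k)⁺, hs, fun k m hkm => ?_, fun k => posPart_nonneg _, fun k => ?_,
    fun k => le_posPart _⟩
  · change |(t k)⁺| ⊓ |(t m)⁺| = 0
    rw [abs_of_nonneg (posPart_nonneg _), abs_of_nonneg (posPart_nonneg _)]
    rcases hkm.lt_or_gt with h | h
    · exact hlt k m h
    · rw [inf_comm]
      exact hlt m k h
  · exact sup_le (sub_le_self _ (add_nonneg (smul_nonneg (by positivity) (hP k))
      (smul_nonneg (by positivity) hs))) (hy k)

/-- A positive sequence of functionals is norm null if it is weak* null and each of its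
subsequences is null along bounded positive disjoint sequences. -/
theorem tendsto_norm_zero_of_disjoint {g : ℕ → StrongDual ℝ E} (hg : ∀ n, 0 ≤ g n)
    (hweak : ∀ x : E, 0 ≤ x → Tendsto (fun n => g n x) atTop (𝓝 0))
    (hdisj : ∀ (φ : ℕ → ℕ) (u : ℕ → E), StrictMono φ → DisjointSeq u → (∀ k, 0 ≤ u k) →
      (∀ k, ‖u k‖ ≤ 1) → Tendsto (fun k => g (φ k) (u k)) atTop (𝓝 0)) :
    Tendsto (fun n => ‖g n‖) atTop (𝓝 0) := by
  choose x hx0 hx1 hgx using fun n => exists_nonneg_norm_le_two_mul_apply (hg n)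
  by_contra hnot
  obtain ⟨ε, hε, hfreq⟩ : ∃ ε > 0, ∃ᶠ n in atTop, ε ≤ ‖g n‖ := by
    by_contra! h
    refine hnot (Metric.tendsto_nhds.2 fun ε hε => ?_)
    simpa using h ε hε
  -- Summing over all indices up to `a`, not only the selected ones, lets the choice depend on the
  -- last index alone.
  have step : ∀ m a : ℕ, ∃ n, a < n ∧ ε ≤ ‖g n‖ ∧
      g n ((4 : ℝ) ^ m • ∑ i ∈ Finset.range (a + 1), x i) < ε / 8 := fun m a => by
    have h := hweak ((4 : ℝ) ^ m • ∑ i ∈ Finset.range (a + 1), x i)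
      (smul_nonneg (by positivity) (Finset.sum_nonneg fun i _ => hx0 i))
    have h' := (h.eventually_lt_const (show (0 : ℝ) < ε / 8 by positivity)).and
      (eventually_gt_atTop a)
    obtain ⟨n, h₁, h₂, h₃⟩ := (hfreq.and_eventually h').exists
    exact ⟨n, h₃, h₁, h₂⟩
  choose N hN₁ hN₂ hN₃ using step
  let φ : ℕ → ℕ := fun k => Nat.rec (N 0 0) (fun k a => N (k + 1) a) k
  have hφ : StrictMono φ := strictMono_nat_of_lt_succ fun k => hN₁ (k + 1) (φ k)
  have hφε : ∀ k, ε ≤ ‖g (φ k)‖ := fun k => by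
    cases k with
    | zero => exact hN₂ 0 0
    | succ k => exact hN₂ (k + 1) (φ k)
  have hφs : ∀ k, g (φ k) ((4 : ℝ) ^ k • ∑ i ∈ Finset.range k, x (φ i)) < ε / 8 := fun k => by
    cases k with
    | zero => simpa using hε
    | succ k =>
      refine (apply_le_apply (hg _) ?_).trans_lt (hN₃ (k + 1) (φ k))
      refine smul_le_smul_of_nonneg_left ?_ (by positivity)
      rw [← Finset.sum_image (f := x) (g := φ) hφ.injective.injOn]
      refine Finset.sum_le_sum_of_subset_of_nonneg (fun i hi => ?_) fun i _ _ => hx0 i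
      obtain ⟨j, hj, rfl⟩ := Finset.mem_image.1 hi
      have := hφ.monotone (Nat.lt_succ_iff.1 (Finset.mem_range.1 hj))
      exact Finset.mem_range.2 (Nat.lt_succ_iff.2 this)
  obtain ⟨s, u, hs, hu, hu0, huy, hyu⟩ :=
    exists_disjointSeq_of_bounded (fun k => hx0 (φ k)) (fun k => hx1 (φ k))
  have hnull := hdisj φ u hφ hu hu0 fun k => by
    refine (norm_le_norm_of_abs_le_abs ?_).trans (hx1 (φ k))
    rw [abs_of_nonneg (hu0 k), abs_of_nonneg (hx0 _)]
    exact huy k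
  have hs' := (hweak s hs).comp hφ.tendsto_atTop
  obtain ⟨k, hk₁, hk₂⟩ :=
    ((hnull.eventually_lt_const (show (0 : ℝ) < ε / 8 by positivity)).and
      (hs'.eventually_lt_const (show (0 : ℝ) < ε / 8 by positivity))).exists
  -- The contradiction: `ε / 2 ≤ g (φ k) (x (φ k)) < 3 * (ε / 8)`.
  have h₁ := apply_le_apply (hg (φ k)) (hyu k)
  simp only [map_sub, map_add, map_smul _ ((1 / 2 : ℝ) ^ k), smul_eq_mul] at h₁
  have h₂ := hφs k
  have h₃ : (1 / 2 : ℝ) ^ k * g (φ k) s ≤ g (φ k) s :=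
    mul_le_of_le_one_left (by simpa using hg (φ k) s hs)
      (pow_le_one₀ (by norm_num) (by norm_num))
  have h₄ := hφε k
  have h₅ := hgx (φ k)
  simp only [Function.comp_apply] at hk₂
  linarith

end BanachLat

/-! ### The adjoint operator -/

open BanachLat in
theorem theorem3p8 {E F : Type*}
    [NormedAddCommGroup E] [NormedSpace ℝ E] [CompleteSpace E]
    [Lattice E] [IsOrderedAddMonoid E] [IsOrderedModule ℝ E] [HasSolidNorm E]
    [NormedAddCommGroup F] [NormedSpace ℝ F] [CompleteSpace F]
    [Lattice F] [IsOrderedAddMonoid F] [IsOrderedModule ℝ F] [HasSolidNorm F]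
    (p : ℝ) (hp : 1 ≤ p)
    (h : BanachLat.DisjointProperty p E ∨
      BanachLat.PositiveSchurProperty p (StrongDual ℝ F))
    (T : E →L[ℝ] F) (hT : BanachLat.PositiveOperator T)
    (hTp : BanachLat.DisjointPConvergent p T) :
    BanachLat.DisjointPConvergent p (BanachLat.adjointOp T) := by
  intro f hf hfw
  have p0 : 0 < p := by linarith
  have habs := weaklyPSummable_abs hp hf hfw
  rcases h with hE | hF
  · obtain ⟨C, hC⟩ := bounded_of_weakly_bounded (w := fun n => |f n|) fun ψ => by
      obtain ⟨D, hD⟩ := (habs ψ).tendsto_atTop_zero.bddAbove_range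
      refine ⟨D ^ (1 / p), fun n => ?_⟩
      have h₁ : |ψ (|f n|)| ^ p ≤ D := hD ⟨n, rfl⟩
      calc |ψ (|f n|)| = (|ψ (|f n|)| ^ p) ^ (1 / p) := by
            rw [← Real.rpow_mul (abs_nonneg _), mul_one_div_cancel p0.ne', Real.rpow_one]
        _ ≤ _ := Real.rpow_le_rpow (by positivity) h₁ (by positivity)
    have hnull : Tendsto (fun n => ‖adjointOp T |f n|‖) atTop (𝓝 0) := by
      refine tendsto_norm_zero_of_disjoint
        (fun n x hx => by simpa [adjointOp_apply] using abs_nonneg (f n) (T x) (hT x hx))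
        (fun x _ => ?_) fun φ u _ hu _ hu1 => ?_
      -- Weak* nullness: `habs` is tested on evaluation at `T x`.
      · have h₁ := (habs (NormedSpace.inclusionInDoubleDual ℝ F (T x))).tendsto_atTop_zero
        have h₂ := h₁.rpow_const (p := 1 / p) (Or.inr (by positivity))
        rw [Real.zero_rpow (by positivity)] at h₂
        refine (tendsto_zero_iff_abs_tendsto_zero _).2 (h₂.congr fun n => ?_)
        rw [← Real.rpow_mul (abs_nonneg _), mul_one_div_cancel p0.ne', Real.rpow_one]
        rfl
      · have h₁ := (hTp u hu (hE u hu ⟨1, hu1⟩)).const_mul C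
        rw [mul_zero] at h₁
        refine squeeze_zero_norm (fun k => ?_) h₁
        exact ((|f (φ k)|).le_opNorm (T (u k))).trans (by gcongr; exact hC _)
    refine squeeze_zero (fun n => norm_nonneg _) (fun n => ?_) hnull
    refine norm_le_norm_of_abs_le_abs (le_trans (abs_le'.2 ⟨fun x hx => ?_, fun x hx => ?_⟩)
      (le_abs_self _))
    · exact le_abs_self (f n) (T x) (hT x hx)
    · exact neg_le_abs (f n) (T x) (hT x hx)
  · have h₁ := (hF _ (fun n => abs_nonneg (f n)) habs).const_mul ‖adjointOp T‖
    rw [mul_zero] at h₁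
    refine squeeze_zero (fun n => norm_nonneg _) (fun n => ?_) h₁
    rw [norm_abs_eq_norm]
    exact (adjointOp T).le_opNorm _
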